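/- A closure space is a pair $(A,\mathcal C_A)$ where $A$ is a set and $\mathcal C_A$ is a set of subsets of $A$ (the closed subsets) closed under arbitrary intersections, the empty intersection $A$ included. Let $\mathbf{CLS}$ be the category whose objects are the closure spaces and whose morphisms $A\to B$ are the maps $\alpha:A\to B$ such that $\alpha^{-1}(B')\in\mathcal C_A$ for every $B'\in\mathcal C_B$; it has pullbacks. A morphism $p:E\to B$ of $\mathbf{CLS}$ is a closed map if $p(Y)\in\mathcal C_B$ for every $Y\in\mathcal C_E$, and an open map if, for every $Y\subseteq E$ with $E\setminus Y\in\mathcal C_E$, one has $B\setminus p(Y)\in\mathcal C_B$. Let $p:E\to B$ be a morphism in a category with pullbacks. A descent data for $p$ is a triple $(C,\gamma,\xi)$ with $\gamma:C\to E$ and $\xi:E\times_B C\to C$ (the pullback of $p$ and $p\gamma$, with projections $\pi_1,\pi_2$) such that $\gamma\xi=\pi_1$, $\xi\langle\gamma,1_C\rangle=1_C$ and $\xi(E\times_B\xi)=\xi(E\times_B\pi_2)$ as morphisms $E\times_B(E\times_B C)\to C$, where $E\times_B C$ is regarded as an object over $B$ via $p\pi_1$. A morphism $(C,\gamma,\xi)\to(C',\gamma',\xi')$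 of descent data is a morphism $h:C\to C'$ with $\gamma'h=\gamma$ and $h\xi=\xi'(E\times_B h)$. Let $\mathrm{Des}(p)$ be the resulting category. The comparison functor $K^p$, from the category of objects over $B$ to $\mathrm{Des}(p)$, sends $\alpha:A\to B$ to the triple $(E\times_B A,\ \pi_1,\ E\times_B\pi_2)$, where $\pi_1:E\times_B A\to E$ and $E\times_B\pi_2:E\times_B(E\times_B A)\to E\times_B A$, and sends a morphism $f$ over $B$ to $E\times_B f$. The morphism $p$ is called an effective descent morphism if $K^p$ is an equivalence of categories. Theorem. Every surjective closed map and every surjective open map of closure spaces is an effective descent morphism in $\mathbf{CLS}$. -/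

import Mathlib

open CategoryTheory CategoryTheory.Limits

universe v u

/-! ### Closure spaces -/

/-- A closure space: a set `carrier` with a set `closed` of subsets of it that is closed under
arbitrary intersections (the empty intersection, which is the whole set, included). -/
structure CLS : Type (u + 1) where
  carrier : Type u
  closed : Set (Set carrier)
  sInter_mem : ∀ S : Set (Set carrier), S ⊆ closed → ⋂₀ S ∈ closed

namespace CLS

/-- A morphism of closure spaces: a map under which preimages of closed sets are closed. -/
@[ext]
structure Hom (A B : CLS.{u}) : Type u where
  toFun : A.carrier → B.carrier
  preimage_mem : ∀ Y ∈ B.closed, toFun ⁻¹' Y ∈ A.closed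

/-- The category of closure spaces, with the composition of maps. -/
instance : Category CLS.{u} where
  Hom A B := Hom A B
  id A := ⟨id, fun _ hY => hY⟩
  comp f g := ⟨g.toFun ∘ f.toFun, fun Y hY => f.preimage_mem _ (g.preimage_mem Y hY)⟩

@[simp]
theorem id_toFun (A : CLS.{u}) : Hom.toFun (𝟙 A) = id := rfl

@[simp]
theorem comp_toFun {A B C : CLS.{u}} (f : A ⟶ B) (g : B ⟶ C) :
    Hom.toFun (f ≫ g) = Hom.toFun g ∘ Hom.toFun f := rfl

theorem hom_ext {A B : CLS.{u}} {f g : A ⟶ B}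
    (h : ∀ a, Hom.toFun f a = Hom.toFun g a) : f = g :=
  Hom.ext (funext h)

/-- `p` is a surjective map. -/
def Surjective {E B : CLS.{u}} (p : E ⟶ B) : Prop :=
  Function.Surjective (Hom.toFun p)

/-- `p` is closed: images of closed subsets are closed. -/
def IsClosedMap {E B : CLS.{u}} (p : E ⟶ B) : Prop :=
  ∀ Y : Set E.carrier, Y ∈ E.closed → Hom.toFun p '' Y ∈ B.closed

/-- `p` is open: images of open subsets (those with a closed complement) are open. -/
def IsOpenMap {E B : CLS.{u}} (p : E ⟶ B) : Prop :=
  ∀ Y : Set E.carrier, Yᶜ ∈ E.closed → (Hom.toFun p '' Y)ᶜ ∈ B.closed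

/-! ### Pullbacks of closure spaces -/

theorem inter_mem (A : CLS.{u}) {X Y : Set A.carrier} (hX : X ∈ A.closed) (hY : Y ∈ A.closed) :
    X ∩ Y ∈ A.closed := by
  rw [← Set.sInter_pair]
  refine A.sInter_mem _ ?_
  rintro Z (rfl | rfl)
  exacts [hX, hY]

theorem univ_mem (A : CLS.{u}) : Set.univ ∈ A.closed := by
  have h := A.sInter_mem ∅ (Set.empty_subset _)
  rwa [Set.sInter_empty] at h

/-- The closure space `{(e, a) | p e = α a}`, whose closed sets are the sets
`π₁⁻¹(E') ∩ π₂⁻¹(A')` with `E'` and `A'` closed. -/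
def pullbackObj {E A B : CLS.{u}} (p : E ⟶ B) (α : A ⟶ B) : CLS.{u} where
  carrier := {x : E.carrier × A.carrier // Hom.toFun p x.1 = Hom.toFun α x.2}
  closed := {Z | ∃ E' ∈ E.closed, ∃ A' ∈ A.closed,
    Z = (fun x => x.1.1) ⁻¹' E' ∩ (fun x => x.1.2) ⁻¹' A'}
  sInter_mem S hS := by
    choose! X hX Y hY h using hS
    refine ⟨⋂₀ (X '' S), E.sInter_mem _ (Set.image_subset_iff.2 hX),
      ⋂₀ (Y '' S), A.sInter_mem _ (Set.image_subset_iff.2 hY), ?_⟩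
    ext x
    simp only [Set.mem_sInter, Set.mem_inter_iff, Set.mem_preimage, Set.forall_mem_image]
    rw [← forall₂_and]
    refine forall₂_congr fun Z hZ => ?_
    conv_lhs => rw [h hZ]
    rfl

/-- The first projection of the pullback. -/
def pullbackFst {E A B : CLS.{u}} (p : E ⟶ B) (α : A ⟶ B) : pullbackObj p α ⟶ E :=
  Hom.mk (fun x => x.1.1) fun Y hY => ⟨Y, hY, Set.univ, A.univ_mem, (Set.inter_univ _).symm⟩

/-- The second projection of the pullback. -/
def pullbackSnd {E A B : CLS.{u}} (p : E ⟶ B) (α : A ⟶ B) : pullbackObj p α ⟶ A :=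
  Hom.mk (fun x => x.1.2) fun Y hY => ⟨Set.univ, E.univ_mem, Y, hY, (Set.univ_inter _).symm⟩

theorem isPullback {E A B : CLS.{u}} (p : E ⟶ B) (α : A ⟶ B) :
    IsPullback (pullbackFst p α) (pullbackSnd p α) p α :=
  ⟨⟨hom_ext fun x => x.2⟩, ⟨PullbackCone.IsLimit.mk _
    (fun s => Hom.mk
      (fun t => ⟨(Hom.toFun s.fst t, Hom.toFun s.snd t),
        congrFun (congrArg Hom.toFun s.condition) t⟩)
      (by
        rintro _ ⟨E', hE', A', hA', rfl⟩
        exact s.pt.inter_mem (s.fst.preimage_mem _ hE') (s.snd.preimage_mem _ hA')))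
    (fun _ => rfl) (fun _ => rfl)
    (fun s m h₁ h₂ => hom_ext fun t => Subtype.ext (Prod.ext
      (congrFun (congrArg Hom.toFun h₁) t) (congrFun (congrArg Hom.toFun h₂) t)))⟩⟩

instance : HasPullbacks CLS.{u} :=
  haveI : ∀ {X Y Z : CLS.{u}} {f : X ⟶ Z} {g : Y ⟶ Z}, HasLimit (cospan f g) :=
    fun {_ _ _ f g} => (isPullback f g).hasPullback
  hasPullbacks_of_hasLimit_cospan _

end CLS

/-! ### Effective descent morphisms in a category with pullbacks -/

namespace Descent

variable {C : Type u} [Category.{v} C] [HasPullbacks C] {E B : C} (p : E ⟶ B)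

/-- `E ×_B h : E ×_B X ⟶ E ×_B Y`, for a morphism `h` from `(X, x)` to `(Y, y)` over `B`. -/
noncomputable def baseMap {X Y : C} {x : X ⟶ B} {y : Y ⟶ B} (h : X ⟶ Y) (w : h ≫ y = x) :
    pullback p x ⟶ pullback p y :=
  pullback.lift (pullback.fst p x) (pullback.snd p x ≫ h)
    (by rw [Category.assoc, w, pullback.condition])

@[simp]
theorem baseMap_fst {X Y : C} {x : X ⟶ B} {y : Y ⟶ B} (h : X ⟶ Y) (w : h ≫ y = x) :
    baseMap p h w ≫ pullback.fst p y = pullback.fst p x :=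
  pullback.lift_fst _ _ _

@[simp]
theorem baseMap_snd {X Y : C} {x : X ⟶ B} {y : Y ⟶ B} (h : X ⟶ Y) (w : h ≫ y = x) :
    baseMap p h w ≫ pullback.snd p y = pullback.snd p x ≫ h :=
  pullback.lift_snd _ _ _

@[simp]
theorem baseMap_fst_assoc {X Y Z : C} {x : X ⟶ B} {y : Y ⟶ B} (h : X ⟶ Y) (w : h ≫ y = x)
    (k : E ⟶ Z) : baseMap p h w ≫ pullback.fst p y ≫ k = pullback.fst p x ≫ k := by
  rw [← Category.assoc, baseMap_fst]

@[simp]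
theorem baseMap_snd_assoc {X Y Z : C} {x : X ⟶ B} {y : Y ⟶ B} (h : X ⟶ Y) (w : h ≫ y = x)
    (k : Y ⟶ Z) : baseMap p h w ≫ pullback.snd p y ≫ k = pullback.snd p x ≫ h ≫ k := by
  rw [← Category.assoc, baseMap_snd, Category.assoc]

/-- Descent data for `p : E ⟶ B`: a triple `(C, γ, ξ)` with `γ : C ⟶ E` and
`ξ : E ×_B C ⟶ C`, where `C` is over `B` through `γ ≫ p`. In `assoc` the object
`E ×_B (E ×_B C)` is formed with `E ×_B C` over `B` through `π₁ ≫ p`. -/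
structure Data where
  obj : C
  γ : obj ⟶ E
  ξ : pullback p (γ ≫ p) ⟶ obj
  /-- `γ ξ = π₁` -/
  comp_γ : ξ ≫ γ = pullback.fst p (γ ≫ p)
  /-- `ξ ⟨γ, 1⟩ = 1` -/
  unit : pullback.lift γ (𝟙 obj) (by rw [Category.id_comp]) ≫ ξ = 𝟙 obj
  /-- `ξ (E ×_B ξ) = ξ (E ×_B π₂)` -/
  assoc :
    baseMap p (x := pullback.fst p (γ ≫ p) ≫ p) (y := γ ≫ p) ξ
        (by rw [← Category.assoc, comp_γ]) ≫ ξ =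
      baseMap p (x := pullback.fst p (γ ≫ p) ≫ p) (y := γ ≫ p) (pullback.snd p (γ ≫ p))
        pullback.condition.symm ≫ ξ

variable {p}

/-- A morphism of descent data: a morphism over `E` that is compatible with the `ξ`'s. -/
@[ext]
structure Data.Hom (X Y : Data p) where
  hom : X.obj ⟶ Y.obj
  w : hom ≫ Y.γ = X.γ
  comm : X.ξ ≫ hom =
    baseMap p (x := X.γ ≫ p) (y := Y.γ ≫ p) hom (by rw [← Category.assoc, w]) ≫ Y.ξ

/-- The category `Des(p)` of descent data for `p`. -/
noncomputable instance : Category (Data p) where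
  Hom X Y := Data.Hom X Y
  id X :=
    { hom := 𝟙 X.obj
      w := Category.id_comp _
      comm := by
        have h : baseMap p (𝟙 X.obj) (Category.id_comp (X.γ ≫ p)) = 𝟙 _ := by
          apply pullback.hom_ext <;> simp
        rw [h, Category.comp_id, Category.id_comp] }
  comp {X Y Z} f g :=
    { hom := f.hom ≫ g.hom
      w := by rw [Category.assoc, g.w, f.w]
      comm := by
        rw [← Category.assoc, f.comm, Category.assoc, g.comm, ← Category.assoc]
        congr 1
        apply pullback.hom_ext <;> simp }

@[simp]
theorem Data.id_hom (X : Data p) : Data.Hom.hom (𝟙 X) = 𝟙 X.obj := rfl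

@[simp]
theorem Data.comp_hom {X Y Z : Data p} (f : X ⟶ Y) (g : Y ⟶ Z) :
    Data.Hom.hom (f ≫ g) = Data.Hom.hom f ≫ Data.Hom.hom g := rfl

variable (p)

/-- The comparison functor `K^p`, sending `(A, α)` over `B` to
`(E ×_B A, π₁, E ×_B π₂ : E ×_B (E ×_B A) ⟶ E ×_B A)`. -/
noncomputable def comparison : Over B ⥤ Data p where
  obj A :=
    { obj := pullback p A.hom
      γ := pullback.fst p A.hom
      ξ := baseMap p (x := pullback.fst p A.hom ≫ p) (pullback.snd p A.hom)
        pullback.condition.symm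
      comp_γ := baseMap_fst _ _ _
      unit := by
        apply pullback.hom_ext
        · rw [Category.assoc, baseMap_fst]
          exact (pullback.lift_fst _ _ _).trans (Category.id_comp _).symm
        · rw [Category.assoc, baseMap_snd, pullback.lift_snd_assoc]
      assoc := by apply pullback.hom_ext <;> simp }
  map {A A'} f := Data.Hom.mk (baseMap p f.left (Over.w f)) (by simp)
    (by apply pullback.hom_ext <;> simp)
  map_id A := Data.Hom.ext (by
    apply pullback.hom_ext <;> simp)
  map_comp {A A' A''} f g := Data.Hom.ext (by
    apply pullback.hom_ext <;> simp)

/-- `p` is an effective descent morphism: `K^p` is an equivalence of categories. -/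
def IsEffectiveDescent : Prop :=
  (comparison p).IsEquivalence

end Descent

/-! A descent datum `X` transports a point `c` to a point `X.act e c h` over each `e` in the same
fibre of `p` as `γ c`. Identifying points with their transports gives a quotient over `B`, and the
canonical map from `X.obj` to the pullback of this quotient is a bijective morphism for any `p`. It
is an isomorphism once every closed `Z` is `γ⁻¹(E') ∩ D` with `E'` closed and `D` closed and
saturated (`ClosedGenerated`). Closed sets of a pullback are single rectangles, so `ξ⁻¹(Z)` provides
closed `E'` and `D` with `act e c ∈ Z ↔ e ∈ E' ∧ c ∈ D`. Taking `e = γ c` gives `Z = γ⁻¹(E') ∩ D`,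
and only saturation is missing. For closed `p`, intersect `D` with the preimage of `p(E')`; for open
`p`, replace `D` by its largest saturated subset. Full faithfulness holds because closed surjections
and open surjections are stable under pullback and are quotient maps. -/

namespace CLS

/-! ### Pullbacks in coordinates; stability of closed and open surjections -/

section Pullback

variable {E A B : CLS.{u}} (p : E ⟶ B) (f : A ⟶ B)

/-- The point of the pullback with given coordinates. -/
noncomputable def pullbackPt (e : E.carrier) (a : A.carrier)
    (h : Hom.toFun p e = Hom.toFun f a) : (pullback p f).carrier :=
  Hom.toFun (isPullback p f).isoPullback.hom ⟨(e, a), h⟩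

@[simp]
theorem fst_pullbackPt (e : E.carrier) (a : A.carrier) (h : Hom.toFun p e = Hom.toFun f a) :
    Hom.toFun (pullback.fst p f) (pullbackPt p f e a h) = e :=
  congrFun (congrArg Hom.toFun (isPullback p f).isoPullback_hom_fst) ⟨(e, a), h⟩

@[simp]
theorem snd_pullbackPt (e : E.carrier) (a : A.carrier) (h : Hom.toFun p e = Hom.toFun f a) :
    Hom.toFun (pullback.snd p f) (pullbackPt p f e a h) = a :=
  congrFun (congrArg Hom.toFun (isPullback p f).isoPullback_hom_snd) ⟨(e, a), h⟩

theorem pullback_condition_apply (z : (pullback p f).carrier) :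
    Hom.toFun p (Hom.toFun (pullback.fst p f) z) =
      Hom.toFun f (Hom.toFun (pullback.snd p f) z) :=
  congrFun (congrArg Hom.toFun (pullback.condition (f := p) (g := f))) z

theorem pullbackPt_fst_snd (z : (pullback p f).carrier) :
    pullbackPt p f (Hom.toFun (pullback.fst p f) z) (Hom.toFun (pullback.snd p f) z)
      (pullback_condition_apply p f z) = z := by
  have h := congrFun (congrArg Hom.toFun (isPullback p f).isoPullback.inv_hom_id) z
  have h₁ := congrFun (congrArg Hom.toFun (isPullback p f).isoPullback_inv_fst) z
  have h₂ := congrFun (congrArg Hom.toFun (isPullback p f).isoPullback_inv_snd) z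
  refine Eq.trans ?_ h
  exact congrArg (Hom.toFun (isPullback p f).isoPullback.hom)
    (Subtype.ext (Prod.ext h₁.symm h₂.symm))

variable {p f} in
theorem pullback_ext {z w : (pullback p f).carrier}
    (h₁ : Hom.toFun (pullback.fst p f) z = Hom.toFun (pullback.fst p f) w)
    (h₂ : Hom.toFun (pullback.snd p f) z = Hom.toFun (pullback.snd p f) w) : z = w := by
  rw [← pullbackPt_fst_snd p f z, ← pullbackPt_fst_snd p f w]
  congr 1

theorem closed_pullback_iff (Z : Set (pullback p f).carrier) :
    Z ∈ (pullback p f).closed ↔ ∃ E' ∈ E.closed, ∃ A' ∈ A.closed,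
      Z = Hom.toFun (pullback.fst p f) ⁻¹' E' ∩ Hom.toFun (pullback.snd p f) ⁻¹' A' := by
  constructor
  · intro hZ
    obtain ⟨E', hE, A', hA, h⟩ := (isPullback p f).isoPullback.hom.preimage_mem Z hZ
    refine ⟨E', hE, A', hA, Set.ext fun z => ?_⟩
    have := Set.ext_iff.1 h ⟨(Hom.toFun (pullback.fst p f) z, Hom.toFun (pullback.snd p f) z),
      pullback_condition_apply p f z⟩
    change pullbackPt p f _ _ _ ∈ Z ↔ _ at this
    rw [pullbackPt_fst_snd] at this
    exact this
  · rintro ⟨E', hE, A', hA, rfl⟩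
    exact inter_mem _ ((pullback.fst p f).preimage_mem _ hE)
      ((pullback.snd p f).preimage_mem _ hA)

variable {p}

theorem Surjective.pullback_snd (hp : Surjective p) : Surjective (pullback.snd p f) := fun a =>
  let ⟨e, he⟩ := hp (Hom.toFun f a)
  ⟨pullbackPt p f e a he, snd_pullbackPt ..⟩

/-- The image of the rectangle on `E'` and `A'` is `A' ∩ f⁻¹(p(E'))`. -/
theorem IsClosedMap.pullback_snd (hc : IsClosedMap p) : IsClosedMap (pullback.snd p f) := by
  intro Z hZ
  obtain ⟨E', hE, A', hA, rfl⟩ := (closed_pullback_iff p f Z).1 hZ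
  convert A.inter_mem hA (f.preimage_mem _ (hc E' hE)) using 1
  ext a
  constructor
  · rintro ⟨z, ⟨h₁, h₂⟩, rfl⟩
    exact ⟨h₂, _, h₁, pullback_condition_apply p f z⟩
  · rintro ⟨ha, e, he, h⟩
    exact ⟨pullbackPt p f e a h, ⟨by simpa using he, by simpa using ha⟩, snd_pullbackPt ..⟩

/-- If `Yᶜ` is the rectangle on `E'` and `A'`, the complement of the image of `Y` consists of the
points whose whole fibre lies in that rectangle, which is `A' ∩ f⁻¹((p(E'ᶜ))ᶜ)`. Surjectivity makes
fibres nonempty, which forces such points into `A'`. -/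
theorem IsOpenMap.pullback_snd (hp : Surjective p) (ho : IsOpenMap p) :
    IsOpenMap (pullback.snd p f) := by
  intro Y hY
  obtain ⟨E', hE, A', hA, hYe⟩ := (closed_pullback_iff p f _).1 hY
  convert A.inter_mem hA (f.preimage_mem _ (ho E'ᶜ (by rwa [compl_compl]))) using 1
  ext a
  have hmem : ∀ z, z ∉ Y ↔ Hom.toFun (pullback.fst p f) z ∈ E' ∧
      Hom.toFun (pullback.snd p f) z ∈ A' := Set.ext_iff.1 hYe
  constructor
  · intro ha
    have hfib : ∀ e (h : Hom.toFun p e = Hom.toFun f a), e ∈ E' ∧ a ∈ A' := fun e h => by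
      simpa using (hmem (pullbackPt p f e a h)).1 fun hz => ha ⟨_, hz, snd_pullbackPt ..⟩
    refine ⟨?_, ?_⟩
    · obtain ⟨e, he⟩ := hp (Hom.toFun f a)
      exact (hfib e he).2
    · rintro ⟨e, he, h⟩
      exact he (hfib e h).1
  · rintro ⟨ha, hb⟩ ⟨z, hz, rfl⟩
    refine (hmem z).2 ⟨?_, ha⟩ hz
    by_contra hE'
    exact hb ⟨_, hE', pullback_condition_apply p f z⟩

end Pullback

/-- A map is a quotient map if a set with closed preimage is closed. -/
def IsQuotientMap {A B : CLS.{u}} (q : A ⟶ B) : Prop :=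
  Surjective q ∧ ∀ Z : Set B.carrier, Hom.toFun q ⁻¹' Z ∈ A.closed → Z ∈ B.closed

theorem IsClosedMap.isQuotientMap {A B : CLS.{u}} {q : A ⟶ B} (hc : IsClosedMap q)
    (hq : Surjective q) : IsQuotientMap q :=
  ⟨hq, fun Z hZ => by
    have := hc _ hZ
    rwa [Set.image_preimage_eq Z hq] at this⟩

theorem IsOpenMap.isQuotientMap {A B : CLS.{u}} {q : A ⟶ B} (ho : IsOpenMap q)
    (hq : Surjective q) : IsQuotientMap q :=
  ⟨hq, fun Z hZ => by
    have := ho (Hom.toFun q ⁻¹' Zᶜ) (by rwa [Set.preimage_compl, compl_compl])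
    rwa [Set.image_preimage_eq _ hq, compl_compl] at this⟩

end CLS

/-! ### Descent data as transports between fibres -/

namespace Descent

open CLS

variable {E B : CLS.{u}} {p : E ⟶ B}

@[simp]
theorem baseMap_pullbackPt {X Y : CLS.{u}} {x : X ⟶ B} {y : Y ⟶ B} (h : X ⟶ Y) (w : h ≫ y = x)
    (e : E.carrier) (a : X.carrier) (hea : Hom.toFun p e = Hom.toFun x a) :
    Hom.toFun (baseMap p h w) (pullbackPt p x e a hea) =
      pullbackPt p y e (Hom.toFun h a) (by rw [hea, ← w]; rfl) := by
  apply pullback_ext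
  · rw [fst_pullbackPt]
    exact (congrFun (congrArg Hom.toFun (baseMap_fst p h w)) (pullbackPt p x e a hea)).trans
      (fst_pullbackPt ..)
  · rw [snd_pullbackPt]
    exact (congrFun (congrArg Hom.toFun (baseMap_snd p h w)) (pullbackPt p x e a hea)).trans
      (congrArg (Hom.toFun h) (snd_pullbackPt ..))

namespace Data

/-- The image in `B` of a point of a descent datum. -/
abbrev base (X : Data p) (c : X.obj.carrier) : B.carrier :=
  Hom.toFun (X.γ ≫ p) c

/-- The transport of a point `c` to the fibre over `e`. -/
noncomputable def act (X : Data p) (e : E.carrier) (c : X.obj.carrier)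
    (h : Hom.toFun p e = X.base c) : X.obj.carrier :=
  Hom.toFun X.ξ (pullbackPt p (X.γ ≫ p) e c h)

variable (X : Data p)

theorem γ_act (e : E.carrier) (c : X.obj.carrier) (h : Hom.toFun p e = X.base c) :
    Hom.toFun X.γ (X.act e c h) = e :=
  (congrFun (congrArg Hom.toFun X.comp_γ) _).trans (fst_pullbackPt ..)

theorem base_act (e : E.carrier) (c : X.obj.carrier) (h : Hom.toFun p e = X.base c) :
    X.base (X.act e c h) = X.base c := by
  exact (congrArg (Hom.toFun p) (X.γ_act e c h)).trans h

theorem act_γ (c : X.obj.carrier) : X.act (Hom.toFun X.γ c) c rfl = c := by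
  refine Eq.trans ?_ (congrFun (congrArg CLS.Hom.toFun X.unit) c)
  refine congrArg (Hom.toFun X.ξ) (pullback_ext ?_ ?_)
  · rw [fst_pullbackPt]
    exact (congrFun (congrArg CLS.Hom.toFun (pullback.lift_fst (f := p) (g := X.γ ≫ p) X.γ (𝟙 X.obj)
      (by rw [Category.id_comp]))) c).symm
  · rw [snd_pullbackPt]
    exact (congrFun (congrArg CLS.Hom.toFun (pullback.lift_snd (f := p) (g := X.γ ≫ p) X.γ (𝟙 X.obj)
      (by rw [Category.id_comp]))) c).symm

theorem act_eq_self {e : E.carrier} {c : X.obj.carrier} (he : e = Hom.toFun X.γ c)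
    (h : Hom.toFun p e = X.base c) : X.act e c h = c := by
  subst he
  exact X.act_γ c

theorem act_act (e e' : E.carrier) (c : X.obj.carrier) (h' : Hom.toFun p e' = X.base c)
    (h : Hom.toFun p e = X.base c) :
    X.act e (X.act e' c h') (h.trans (X.base_act e' c h').symm) = X.act e c h := by
  have hz : Hom.toFun p e = Hom.toFun (pullback.fst p (X.γ ≫ p) ≫ p)
      (pullbackPt p (X.γ ≫ p) e' c h') := by
    rw [comp_toFun, Function.comp_apply, fst_pullbackPt, h, h']
  have := congrFun (congrArg CLS.Hom.toFun X.assoc)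
    (pullbackPt p _ e (pullbackPt p (X.γ ≫ p) e' c h') hz)
  simp only [comp_toFun, Function.comp_apply, baseMap_pullbackPt, snd_pullbackPt] at this
  exact this

theorem ξ_apply (z : (pullback p (X.γ ≫ p)).carrier) :
    Hom.toFun X.ξ z = X.act (Hom.toFun (pullback.fst p (X.γ ≫ p)) z)
      (Hom.toFun (pullback.snd p (X.γ ≫ p)) z) (pullback_condition_apply p _ z) :=
  (congrArg (Hom.toFun X.ξ) (pullbackPt_fst_snd p (X.γ ≫ p) z)).symm

/-! ### The quotient of a descent datum -/

/-- Two points are identified if they have the same base point and the same transports. -/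
def setoid : Setoid X.obj.carrier where
  r c c' := X.base c = X.base c' ∧ ∀ e h h', X.act e c h = X.act e c' h'
  iseqv :=
    { refl := fun _ => ⟨rfl, fun _ _ _ => rfl⟩
      symm := fun h => ⟨h.1.symm, fun e h₁ h₂ => (h.2 e h₂ h₁).symm⟩
      trans := fun h k => ⟨h.1.trans k.1, fun e h₁ h₂ =>
        (h.2 e h₁ (h₁.trans h.1)).trans (k.2 e (h₁.trans h.1) h₂)⟩ }

theorem setoid_act (e : E.carrier) (c : X.obj.carrier) (h : Hom.toFun p e = X.base c) :
    X.setoid (X.act e c h) c :=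
  ⟨X.base_act e c h, fun e' _ h' => X.act_act e' e c h h'⟩

-- With `setoid_act`, this shows that the equivalence classes are the orbits of the transport.
variable {X} in
theorem eq_act_of_setoid {c c' : X.obj.carrier} (h : X.setoid c c') :
    X.act (Hom.toFun X.γ c') c h.1.symm = c' :=
  (h.2 _ h.1.symm rfl).trans (X.act_γ c')

/-- The quotient of a descent datum by its action. -/
def quotient : CLS.{u} where
  carrier := Quotient X.setoid
  closed := {Z | Quotient.mk X.setoid ⁻¹' Z ∈ X.obj.closed}
  sInter_mem S hS := by
    have := X.obj.sInter_mem (Set.preimage (Quotient.mk X.setoid) '' S)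
      (Set.image_subset_iff.2 hS)
    rwa [Set.sInter_image, ← Set.preimage_iInter₂, ← Set.sInter_eq_biInter] at this

/-- The structure map of the quotient. -/
def quotientHom : X.quotient ⟶ B :=
  CLS.Hom.mk (Quotient.lift X.base fun _ _ h => h.1)
    fun _ hY => X.γ.preimage_mem _ (p.preimage_mem _ hY)

/-- The quotient map. -/
def quotientMk : X.obj ⟶ X.quotient :=
  CLS.Hom.mk (Quotient.mk X.setoid) fun _ h => h

/-- The canonical comparison of a descent datum with the one induced by its quotient. -/
noncomputable def toPullback : X.obj ⟶ pullback p X.quotientHom :=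
  pullback.lift X.γ X.quotientMk rfl

theorem toPullback_fst : X.toPullback ≫ pullback.fst p X.quotientHom = X.γ :=
  pullback.lift_fst _ _ _

theorem toPullback_snd : X.toPullback ≫ pullback.snd p X.quotientHom = X.quotientMk :=
  pullback.lift_snd _ _ _

theorem ξ_quotientMk : X.ξ ≫ X.quotientMk = pullback.snd p (X.γ ≫ p) ≫ X.quotientMk :=
  CLS.hom_ext fun z =>
    (congrArg (Quotient.mk X.setoid) (X.ξ_apply z)).trans (Quotient.sound (X.setoid_act _ _ _))

theorem ξ_toPullback : X.ξ ≫ X.toPullback =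
    baseMap p (x := X.γ ≫ p) (y := pullback.fst p X.quotientHom ≫ p) X.toPullback
        (by rw [← Category.assoc, toPullback_fst]) ≫
      baseMap p (pullback.snd p X.quotientHom) pullback.condition.symm := by
  apply pullback.hom_ext
  · rw [Category.assoc, Category.assoc, baseMap_fst, baseMap_fst, toPullback_fst, comp_γ]
  · rw [Category.assoc, Category.assoc, baseMap_snd, baseMap_snd_assoc, toPullback_snd,
      ξ_quotientMk]

theorem fst_toPullback (c : X.obj.carrier) :
    Hom.toFun (pullback.fst p X.quotientHom) (Hom.toFun X.toPullback c) = Hom.toFun X.γ c :=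
  congrFun (congrArg CLS.Hom.toFun X.toPullback_fst) c

theorem snd_toPullback (c : X.obj.carrier) :
    Hom.toFun (pullback.snd p X.quotientHom) (Hom.toFun X.toPullback c) =
      Quotient.mk X.setoid c :=
  congrFun (congrArg CLS.Hom.toFun X.toPullback_snd) c

/-- Each equivalence class over `b` has exactly one point over each `e` with `p e = b`, namely the
transport to `e`. -/
theorem toPullback_bijective : Function.Bijective (Hom.toFun X.toPullback) := by
  constructor
  · intro c c' h
    have h₁ := congrArg (Hom.toFun (pullback.fst p X.quotientHom)) h
    have h₂ := congrArg (Hom.toFun (pullback.snd p X.quotientHom)) h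
    rw [fst_toPullback, fst_toPullback] at h₁
    rw [snd_toPullback, snd_toPullback] at h₂
    have hr : X.setoid c c' := Quotient.exact h₂
    exact (X.act_eq_self h₁.symm hr.1.symm).symm.trans (eq_act_of_setoid hr)
  · intro z
    obtain ⟨c, hc⟩ := Quotient.exists_rep (Hom.toFun (pullback.snd p X.quotientHom) z)
    have hz : Hom.toFun p (Hom.toFun (pullback.fst p X.quotientHom) z) = X.base c := by
      rw [pullback_condition_apply, ← hc]
      rfl
    refine ⟨X.act _ c hz, pullback_ext ?_ ?_⟩
    · rw [fst_toPullback, γ_act]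
    · rw [snd_toPullback, ← hc]
      exact Quotient.sound (X.setoid_act _ _ _)

/-! ### Closed sets of a descent datum and essential surjectivity -/

/-- Every closed set of the descent datum is cut out by a closed set of `E` and a saturated
closed set. -/
def ClosedGenerated : Prop :=
  ∀ Z ∈ X.obj.closed, ∃ E' ∈ E.closed, ∃ D ∈ X.obj.closed,
    (∀ c c', X.setoid c c' → c ∈ D → c' ∈ D) ∧ Z = Hom.toFun X.γ ⁻¹' E' ∩ D

theorem exists_closed_act_mem_iff {Z : Set X.obj.carrier} (hZ : Z ∈ X.obj.closed) :
    ∃ E' ∈ E.closed, ∃ D ∈ X.obj.closed, ∀ e c h, X.act e c h ∈ Z ↔ e ∈ E' ∧ c ∈ D := by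
  obtain ⟨E', hE, D, hD, h⟩ := (closed_pullback_iff p _ _).1 (X.ξ.preimage_mem Z hZ)
  refine ⟨E', hE, D, hD, fun e c hec => ?_⟩
  have := Set.ext_iff.1 h (pullbackPt p (X.γ ≫ p) e c hec)
  rw [Set.mem_preimage, Set.mem_inter_iff, Set.mem_preimage, Set.mem_preimage, fst_pullbackPt,
    snd_pullbackPt] at this
  exact this

theorem closedGenerated_of_isClosedMap (hc : IsClosedMap p) : X.ClosedGenerated := by
  intro Z hZ
  obtain ⟨E', hE, D, hD, hact⟩ := X.exists_closed_act_mem_iff hZ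
  have hmem : ∀ c, c ∈ Z ↔ Hom.toFun X.γ c ∈ E' ∧ c ∈ D := fun c => by
    rw [← hact _ _ rfl, act_γ]
  refine ⟨E', hE, D ∩ X.base ⁻¹' (Hom.toFun p '' E'), X.obj.inter_mem hD
    (X.γ.preimage_mem _ (p.preimage_mem _ (hc E' hE))), ?_, ?_⟩
  -- A point `e` of `E'` below `c` and `c'` transports both to the same point, which is in `Z`
  -- because `c ∈ D`; hence `c' ∈ D`.
  · rintro c c' hr ⟨hcD, e, he, heb⟩
    refine ⟨((hact e c' (heb.trans hr.1)).1 ?_).2, e, he, heb.trans hr.1⟩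
    rw [← hr.2 e heb (heb.trans hr.1)]
    exact (hact e c heb).2 ⟨he, hcD⟩
  · ext c
    rw [hmem]
    exact ⟨fun h => ⟨h.1, h.2, _, h.1, rfl⟩, fun h => ⟨h.1, h.2.1⟩⟩

theorem closedGenerated_of_isOpenMap (hp : Surjective p) (ho : IsOpenMap p) :
    X.ClosedGenerated := by
  intro Z hZ
  obtain ⟨E', hE, D, hD, hact⟩ := X.exists_closed_act_mem_iff hZ
  have hmem : ∀ c, c ∈ Z ↔ Hom.toFun X.γ c ∈ E' ∧ c ∈ D := fun c => by
    rw [← hact _ _ rfl, act_γ]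
  have hopen := IsOpenMap.pullback_snd (X.γ ≫ p) hp ho (Hom.toFun X.ξ ⁻¹' Dᶜ)
    (by rw [Set.preimage_compl, compl_compl]; exact X.ξ.preimage_mem D hD)
  -- The closed set `hopen` is the largest saturated subset of `D`: a point is excluded exactly when
  -- some transport of it leaves `D`.
  have hS : ∀ c, c ∈ (Hom.toFun (pullback.snd p (X.γ ≫ p)) '' (Hom.toFun X.ξ ⁻¹' Dᶜ))ᶜ ↔
      ∀ c', X.setoid c c' → c' ∈ D := by
    intro c
    constructor
    · intro h c' hr
      by_contra hc'
      refine h ⟨pullbackPt p (X.γ ≫ p) (Hom.toFun X.γ c') c hr.1.symm, ?_, snd_pullbackPt ..⟩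
      have : X.act (Hom.toFun X.γ c') c hr.1.symm ∉ D := by rwa [eq_act_of_setoid hr]
      exact this
    · rintro h ⟨z, hz, rfl⟩
      refine hz ?_
      rw [ξ_apply]
      exact h _ (X.setoid.symm (X.setoid_act ..))
  refine ⟨E', hE, _, hopen, ?_, ?_⟩
  · intro c c' hr h
    rw [hS] at h ⊢
    exact fun c'' hr' => h c'' (X.setoid.trans hr hr')
  · ext c
    rw [Set.mem_inter_iff, hS, hmem]
    refine ⟨fun h => ⟨h.1, fun c' hr => ?_⟩, fun h => ⟨h.1, h.2 c (X.setoid.refl c)⟩⟩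
    -- Transporting `c'` to the fibre of `c` gives back `c ∈ Z`, so `c' ∈ D`.
    refine ((hact (Hom.toFun X.γ c) c' hr.1).1 ?_).2
    rw [← hr.2 _ rfl hr.1]
    exact (hact _ c rfl).2 h

variable {X}

theorem ClosedGenerated.image_toPullback_mem (hX : X.ClosedGenerated) {Z : Set X.obj.carrier}
    (hZ : Z ∈ X.obj.closed) : Hom.toFun X.toPullback '' Z ∈ (pullback p X.quotientHom).closed := by
  obtain ⟨E', hE, D, hD, hsat, rfl⟩ := hX Z hZ
  have hDq : ∀ c, Quotient.mk X.setoid c ∈ Quotient.mk X.setoid '' D ↔ c ∈ D := fun c =>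
    ⟨fun ⟨c', hc', h⟩ => hsat c' c (Quotient.exact h) hc', fun h => ⟨c, h, rfl⟩⟩
  refine (closed_pullback_iff p _ _).2 ⟨E', hE, Quotient.mk X.setoid '' D, ?_, ?_⟩
  · have : Quotient.mk X.setoid ⁻¹' (Quotient.mk X.setoid '' D) = D := Set.ext hDq
    change Quotient.mk X.setoid ⁻¹' (Quotient.mk X.setoid '' D) ∈ X.obj.closed
    rwa [this]
  · ext z
    obtain ⟨c, rfl⟩ := X.toPullback_bijective.2 z
    rw [X.toPullback_bijective.1.mem_set_image, Set.mem_inter_iff, Set.mem_inter_iff,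
      Set.mem_preimage, Set.mem_preimage, Set.mem_preimage, fst_toPullback, snd_toPullback]
    exact and_congr_right fun _ => (hDq c).symm

theorem ClosedGenerated.isIso_toPullback (hX : X.ClosedGenerated) : IsIso X.toPullback := by
  let φ := Equiv.ofBijective _ X.toPullback_bijective
  refine ⟨CLS.Hom.mk φ.symm fun Z hZ => ?_, CLS.hom_ext φ.symm_apply_apply,
    CLS.hom_ext φ.apply_symm_apply⟩
  rw [← φ.image_eq_preimage_symm]
  exact hX.image_toPullback_mem hZ

variable {Y : Data p}

theorem hom_act (f : X ⟶ Y) (e : E.carrier) (c : X.obj.carrier) (h : Hom.toFun p e = X.base c) :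
    CLS.Hom.toFun (Data.Hom.hom f) (X.act e c h) =
      Y.act e (CLS.Hom.toFun (Data.Hom.hom f) c)
        (h.trans (congrArg (CLS.Hom.toFun p)
          (congrFun (congrArg CLS.Hom.toFun (Data.Hom.w f)) c).symm)) := by
  have := congrFun (congrArg CLS.Hom.toFun (Data.Hom.comm f)) (pullbackPt p (X.γ ≫ p) e c h)
  rw [comp_toFun, comp_toFun, Function.comp_apply, Function.comp_apply, baseMap_pullbackPt] at this
  exact this

end Data

section Iso

variable {𝒞 : Type u} [Category.{v} 𝒞] [HasPullbacks 𝒞] {S T : 𝒞} {q : S ⟶ T}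

theorem isIso_of_isIso_hom {X Y : Data q} (f : X ⟶ Y) [IsIso (Data.Hom.hom f)] : IsIso f := by
  have hw : inv (Data.Hom.hom f) ≫ X.γ = Y.γ := by rw [IsIso.inv_comp_eq, Data.Hom.w]
  let g : Data.Hom Y X :=
    { hom := inv (Data.Hom.hom f)
      w := hw
      comm := by
        rw [IsIso.comp_inv_eq, Category.assoc, Data.Hom.comm, ← Category.assoc]
        refine (Category.id_comp _).symm.trans ?_
        congr 1
        apply pullback.hom_ext <;> simp }
  exact ⟨g, Data.Hom.ext (IsIso.hom_inv_id _), Data.Hom.ext (IsIso.inv_hom_id _)⟩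

end Iso

/-- The canonical comparison as a morphism of descent data. -/
noncomputable def Data.toComparison (X : Data p) :
    X ⟶ (comparison p).obj (Over.mk X.quotientHom) :=
  Data.Hom.mk (Y := (comparison p).obj (Over.mk X.quotientHom)) X.toPullback
    X.toPullback_fst X.ξ_toPullback

theorem comparison_essSurj (h : ∀ X : Data p, X.ClosedGenerated) : (comparison p).EssSurj where
  mem_essImage X := by
    have : IsIso (Data.Hom.hom X.toComparison) := (h X).isIso_toPullback
    have := isIso_of_isIso_hom X.toComparison
    exact ⟨Over.mk X.quotientHom, ⟨(asIso X.toComparison).symm⟩⟩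

/-! ### Full faithfulness of the comparison functor -/

theorem comparison_faithful (hp : CLS.Surjective p) : (comparison p).Faithful where
  map_injective {A A'} f g h := by
    apply Over.OverMorphism.ext
    apply CLS.hom_ext
    intro a
    obtain ⟨e, he⟩ := hp (Hom.toFun A.hom a)
    have h₁ : baseMap p f.left (Over.w f) = baseMap p g.left (Over.w g) :=
      congrArg Data.Hom.hom h
    have h₂ := congrFun (congrArg CLS.Hom.toFun h₁) (pullbackPt p A.hom e a he)
    rw [baseMap_pullbackPt, baseMap_pullbackPt] at h₂
    simpa using congrArg (Hom.toFun (pullback.snd p A'.hom)) h₂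

theorem comparison_full (hq : ∀ {A : CLS.{u}} (f : A ⟶ B), IsQuotientMap (pullback.snd p f)) :
    (comparison p).Full where
  map_surjective {A A'} k := by
    let κ : pullback p A.hom ⟶ pullback p A'.hom := Data.Hom.hom k
    have hκ₁ : κ ≫ pullback.fst p A'.hom = pullback.fst p A.hom := Data.Hom.w k
    have hfst : ∀ z, Hom.toFun (pullback.fst p A'.hom) (Hom.toFun κ z) =
        Hom.toFun (pullback.fst p A.hom) z := congrFun (congrArg CLS.Hom.toFun hκ₁)
    -- Points with the same second coordinate are transports of each other; `κ` commutes with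
    -- transport, which preserves second coordinates.
    have hsnd : ∀ z w, Hom.toFun (pullback.snd p A.hom) z = Hom.toFun (pullback.snd p A.hom) w →
        Hom.toFun (pullback.snd p A'.hom) (Hom.toFun κ z) =
          Hom.toFun (pullback.snd p A'.hom) (Hom.toFun κ w) := by
      intro z w hzw
      have hact : ∀ (D : Over B) (e : E.carrier) (c : (pullback p D.hom).carrier) h,
          Hom.toFun (pullback.snd p D.hom) (((comparison p).obj D).act e c h) =
            Hom.toFun (pullback.snd p D.hom) c := by
        intro D e c h
        have := baseMap_pullbackPt (p := p) (pullback.snd p D.hom) pullback.condition.symm e c h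
        refine (congrArg (Hom.toFun (pullback.snd p D.hom)) this).trans (snd_pullbackPt ..)
      have hw : Hom.toFun p (Hom.toFun (pullback.fst p A.hom) w) =
          ((comparison p).obj A).base z := by
        refine (pullback_condition_apply p A.hom w).trans ?_
        rw [← hzw]
        exact (pullback_condition_apply p A.hom z).symm
      have hzw' : ((comparison p).obj A).act (Hom.toFun (pullback.fst p A.hom) w) z hw = w :=
        pullback_ext (((comparison p).obj A).γ_act _ _ _) ((hact A _ _ _).trans hzw)
      have := Data.hom_act k _ z hw
      rw [hzw'] at this
      exact ((congrArg (Hom.toFun (pullback.snd p A'.hom)) this).trans (hact A' _ _ _)).symm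
    choose s hs using (hq A.hom).1
    have hf : ∀ z, Hom.toFun (pullback.snd p A'.hom)
        (Hom.toFun κ (s (Hom.toFun (pullback.snd p A.hom) z))) =
          Hom.toFun (pullback.snd p A'.hom) (Hom.toFun κ z) := fun z => hsnd _ _ (hs _)
    let f : A.left ⟶ A'.left :=
      CLS.Hom.mk (fun a => Hom.toFun (pullback.snd p A'.hom) (Hom.toFun κ (s a))) fun Y hY => by
        -- The section `s` need not be a morphism: the preimage is tested after pulling back along
        -- the quotient map, where `s` disappears by `hf`.
        refine (hq A.hom).2 _ ?_
        have := (κ ≫ pullback.snd p A'.hom).preimage_mem Y hY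
        convert this using 1
        ext z
        rw [Set.mem_preimage, Set.mem_preimage, hf]
        rfl
    have hfκ : pullback.snd p A.hom ≫ f = κ ≫ pullback.snd p A'.hom := CLS.hom_ext hf
    have hfw : f ≫ A'.hom = A.hom := CLS.hom_ext fun a => by
      refine (pullback_condition_apply p A'.hom _).symm.trans ?_
      rw [hfst, pullback_condition_apply, hs]
    refine ⟨Over.homMk f hfw, Data.Hom.ext ?_⟩
    change baseMap p f hfw = κ
    apply pullback.hom_ext
    · rw [baseMap_fst, hκ₁]
    · rw [baseMap_snd, hfκ]

theorem isEffectiveDescent_of_isQuotientMap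
    (hq : ∀ {A : CLS.{u}} (f : A ⟶ B), IsQuotientMap (pullback.snd p f))
    (hp : CLS.Surjective p) (h : ∀ X : Data p, X.ClosedGenerated) : IsEffectiveDescent p where
  faithful := comparison_faithful hp
  full := comparison_full hq
  essSurj := comparison_essSurj h

end Descent

theorem theorem6p5 {E B : CLS.{u}} (p : E ⟶ B) (hp : CLS.Surjective p) :
    (CLS.IsClosedMap p → Descent.IsEffectiveDescent p) ∧
      (CLS.IsOpenMap p → Descent.IsEffectiveDescent p) :=
  ⟨fun hc => Descent.isEffectiveDescent_of_isQuotientMap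
      (fun f => (hc.pullback_snd f).isQuotientMap (hp.pullback_snd f)) hp
      fun X => X.closedGenerated_of_isClosedMap hc,
    fun ho => Descent.isEffectiveDescent_of_isQuotientMap
      (fun f => (CLS.IsOpenMap.pullback_snd f hp ho).isQuotientMap (hp.pullback_snd f)) hp
      fun X => X.closedGenerated_of_isOpenMap hp ho⟩
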